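/- Let $F$ be a field with a real valuation, i.e. a function $v\colon F\to\mathbb{R}\cup\{\infty\}$ such that $v(x)=\infty$ if and only if $x=0$, $v(x+y)\ge\min\{v(x),v(y)\}$ and $v(xy)=v(x)+v(y)$ for all $x,y\in F$. Suppose that $(F,v)$ is henselian, i.e. that its valuation ring is a henselian local ring. Let $p$ be the characteristic exponent of the residue field $\kappa_F$ of $(F,v)$, that is, $p=1$ if $\operatorname{char}\kappa_F=0$ and $p=\operatorname{char}\kappa_F$ otherwise. Let $E$ be a finite extension of $F$, equipped with the unique real valuation $w$ extending $v$. If the degree $n=[E:F]$ is coprime to $p$, then $E/F$ admits a valuation basis, i.e. there is a basis $\mathbf{e}_1,\dots,\mathbf{e}_n$ of $E$ as an $F$-vector space such that \[ w(c_1\mathbf{e}_1+\cdots+c_n\mathbf{e}_n)=\min_{1\le i\le n} w(c_i\mathbf{e}_i)\qquad\text{for all } c_1,\dots,c_n\in F. \] -/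

import Mathlib

/-- A real Krull valuation on a field `F`: a function `v : F → ℝ ∪ {∞}` with `v x = ∞` iff `x = 0`,
`v (x + y) ≥ min (v x) (v y)` and `v (x * y) = v x + v y`. -/
abbrev RealValuation (F : Type*) [Field F] : Type _ := AddValuation F (WithTop ℝ)

namespace RealValuation

/-- The valuation ring `{x | 0 ≤ v x}` of a real Krull valuation. -/
def valuationRing {F : Type*} [Field F] (v : RealValuation F) : ValuationSubring F where
  carrier := {x | 0 ≤ v x}
  mul_mem' {a b} ha hb := by
    simp only [Set.mem_ofPred_eq] at ha hb ⊢
    rw [v.map_mul]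
    exact add_nonneg ha hb
  one_mem' := by simp
  add_mem' {a b} ha hb := v.map_le_add ha hb
  zero_mem' := by simp
  neg_mem' {a} ha := by
    simp only [Set.mem_ofPred_eq] at ha ⊢
    rwa [v.map_neg]
  mem_or_inv_mem' a := by
    simp only [Set.mem_ofPred_eq]
    by_cases h : a = 0
    · left; simp [h]
    · by_contra! hc
      have h1 : v a + v a⁻¹ = 0 := by rw [← v.map_mul, mul_inv_cancel₀ h, v.map_one]
      have h2 : v a + v a⁻¹ < 0 :=
        (add_le_of_nonpos_right hc.2.le).trans_lt hc.1
      exact h2.ne h1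

/-- The residue field of a real Krull valuation. -/
abbrev ResidueField {F : Type*} [Field F] (v : RealValuation F) : Type _ :=
  IsLocalRing.ResidueField v.valuationRing

/-- `(F, v)` is henselian: its valuation ring satisfies Hensel's lemma. -/
def IsHenselian {F : Type*} [Field F] (v : RealValuation F) : Prop :=
  HenselianLocalRing v.valuationRing

/-- The valuation `w` on `E` extends the valuation `v` on `F`, with the same normalization. -/
def Extends {F E : Type*} [Field F] [Field E] [Algebra F E]
    (w : RealValuation E) (v : RealValuation F) : Prop :=
  ∀ x : F, w (algebraMap F E x) = v x

/-- A basis `e` of a finite extension `E` of `F` is a valuation basis for the valuation `w` of `E`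
if `w (∑ cᵢ eᵢ) = minᵢ w (cᵢ eᵢ)` for all coefficients `cᵢ` in `F`. -/
def IsValuationBasis {F E ι : Type*} [Field F] [Field E] [Algebra F E] [Fintype ι]
    (w : RealValuation E) (e : Module.Basis ι F E) : Prop :=
  ∀ c : ι → F, w (∑ i, c i • e i) = Finset.univ.inf fun i => w (c i • e i)

end RealValuation

/-! For nonzero `e` in `E`, the normalised trace `φ x = n⁻¹ Tr (x e⁻¹)` satisfies `φ e = 1`. If the
trace never lowers the valuation, then `w x ≤ w (φ x • e)`, because coprimality gives `v n = 0`. The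
line `F e` is then orthogonal to `ker φ`, and induction on dimension yields the basis.

The trace bound (`le_map_trace`) is where henselianity enters. Coprimality also makes `E/F`
separable, so `E` lies in a finite Galois extension `N`, in which the integral closure of the
valuation ring is local. A counterexample to the bound rescales to an `x` of trace 1 with `w x > 0`.
Its conjugates are integral non-units, so they lie in the maximal ideal of that local ring; their
sum cannot be 1. Translating between `w` and integrality uses that elements with `w x ≥ 0` are
exactly the integral ones. -/

open Polynomial Pointwise in
/-- If a henselian local ring `A` is the ring of invariants of a finite group `G` acting on an
`A`-algebra `B` that is a domain, then `B` is local. -/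
theorem HenselianLocalRing.isLocalRing_of_isInvariant {A B G : Type*} [CommRing A]
    [HenselianLocalRing A] [CommRing B] [IsDomain B] [Algebra A B] [Group G] [Finite G]
    [MulSemiringAction G B] [SMulCommClass G A B] [Algebra.IsInvariant A B G] :
    IsLocalRing B := by
  classical
  have := Fintype.ofFinite G
  have hint : Algebra.IsIntegral A B := Algebra.IsInvariant.isIntegral A B G
  have hunder : ∀ Q : Ideal B, Q.IsMaximal → Q.under A = IsLocalRing.maximalIdeal A := by
    intro Q hQ
    exact IsLocalRing.eq_maximalIdeal (Ideal.isMaximal_comap_of_isIntegral_of_isMaximal Q)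
  obtain ⟨Q, hQ⟩ := Ideal.exists_maximal B
  refine IsLocalRing.of_unique_max_ideal ⟨Q, hQ, fun Q' hQ' => ?_⟩
  obtain ⟨g₀, hg₀⟩ := Algebra.IsInvariant.exists_smul_of_under_eq A B G Q Q'
    ((hunder Q hQ).trans (hunder Q' hQ').symm)
  rw [hg₀]
  by_contra hne
  have hmax : ∀ I : MulAction.orbit G Q, (I : Ideal B).IsMaximal := by
    rintro ⟨_, g, rfl⟩
    have : (g • Q).IsPrime := hQ.isPrime.smul g
    refine Ideal.isMaximal_of_isIntegral_of_isMaximal_comap (R := A) (g • Q) ?_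
    change ((g • Q).under A).IsMaximal
    rw [Ideal.under_smul, hunder Q hQ]
    infer_instance
  have : Finite (MulAction.orbit G Q) := Set.finite_range _
  obtain ⟨β, hβ⟩ := Ideal.exists_forall_sub_mem_ideal
    (I := fun I : MulAction.orbit G Q => (I : Ideal B))
    (fun I J hIJ => by
      have := hmax I
      have := hmax J
      exact Ideal.isCoprime_of_isMaximal (fun h => hIJ (Subtype.ext h)))
    (fun I => if (I : Ideal B) = Q then 1 else 0)
  let H := MulAction.stabilizer G Q
  have hβ₁ : β - 1 ∈ Q := by simpa using hβ ⟨Q, MulAction.mem_orbit_self Q⟩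
  have hβ₀ : ∀ g : G, g • Q ≠ Q → β ∈ g • Q := fun g hg => by
    simpa [hg] using hβ ⟨g • Q, MulAction.mem_orbit Q g⟩
  -- Multiplying over the stabilizer of `Q` makes `α` invariant under it. Every conjugate of `α`
  -- other than `α` itself then lies in `Q`, so modulo `Q` the orbit polynomial is `(X - 1) * X ^
  -- k`, with 1 a simple root for Hensel to lift.
  let α := ∏ h : H, (h : G) • β
  have hα₁ : Ideal.Quotient.mk Q α = 1 := by
    rw [map_prod]
    refine Finset.prod_eq_one fun h _ => ?_
    rw [← (Ideal.Quotient.mk Q).map_one, Ideal.Quotient.eq]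
    have h1 : (h : G) • (β - 1) ∈ (h : G) • Q := Ideal.smul_mem_pointwise_smul _ _ _ hβ₁
    rwa [show (h : G) • Q = Q from h.2, smul_sub, smul_one] at h1
  have hα₀ : ∀ g : G, g • Q ≠ Q → g • α ∈ Q := fun g hg => by
    have h1 : α ∈ g⁻¹ • Q := by
      have h2 : β ∣ α := by
        simpa using Finset.dvd_prod_of_mem (fun h : H => (h : G) • β) (Finset.mem_univ 1)
      exact Ideal.mem_of_dvd _ h2 (hβ₀ _ fun h => hg (by rw [inv_smul_eq_iff] at h; exact h.symm))
    rwa [Ideal.mem_inv_pointwise_smul_iff] at h1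
  have hαH : ∀ g : G, g • Q = Q → g • α = α := fun g hg => by
    simp only [α, Finset.smul_prod', smul_smul]
    exact Fintype.prod_equiv (Equiv.mulLeft (⟨g, hg⟩ : H)) _ _ fun h => rfl
  obtain ⟨P, hP, -, hPm⟩ := Polynomial.lifts_and_natDegree_eq_and_monic
    ((prodXSubSMul G B α).lifts_iff_coeff_lifts.mpr fun n =>
      Algebra.IsInvariant.isInvariant (A := A) (G := G) _
        fun g => prodXSubSMul.coeff G B α g n) (prodXSubSMul.monic G B α)
  have hPQ : ∃ k : ℕ, (prodXSubSMul G B α).map (Ideal.Quotient.mk Q) = (X - 1) * X ^ k := by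
    rw [prodXSubSMul, Polynomial.map_prod,
      ← Finset.mul_prod_erase _ _ (Finset.mem_univ (QuotientGroup.mk 1))]
    refine ⟨_, congr_arg₂ _ ?_ (Finset.prod_eq_pow_card fun c hc => ?_)⟩
    · simp [hα₁]
    · induction c using QuotientGroup.induction_on with
      | H g =>
        have : g • Q ≠ Q := fun h => by
          refine (Finset.mem_erase.mp hc).1 (QuotientGroup.eq.mpr ?_).symm
          simpa [MulAction.mem_stabilizer_iff] using hαH g h
        simp [MulAction.ofQuotientStabilizer_mk, Ideal.Quotient.eq_zero_iff_mem.mpr (hα₀ g this)]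
  obtain ⟨k, hk⟩ := hPQ
  have hmem : ∀ a : A, a ∈ IsLocalRing.maximalIdeal A ↔
      Ideal.Quotient.mk Q (algebraMap A B a) = 0 := fun a => by
    rw [Ideal.Quotient.eq_zero_iff_mem, ← hunder Q hQ]; rfl
  have heval : ∀ p : A[X], Ideal.Quotient.mk Q (algebraMap A B (p.eval 1)) =
      ((p.map (algebraMap A B)).map (Ideal.Quotient.mk Q)).eval 1 := fun p => by
    rw [Polynomial.map_map, ← (((Ideal.Quotient.mk Q).comp (algebraMap A B))).map_one,
      Polynomial.eval_map, Polynomial.eval₂_at_apply]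
    simp
  obtain ⟨a, ha, -⟩ := HenselianLocalRing.is_henselian P hPm 1
    (by rw [hmem, heval, hP, hk]; simp)
    (by
      by_contra h
      have h1 := (hmem _).mp ((IsLocalRing.mem_maximalIdeal _).mpr h)
      rw [heval, ← Polynomial.derivative_map, ← Polynomial.derivative_map, hP, hk] at h1
      simp at h1)
  have hroot : (prodXSubSMul G B α).eval (algebraMap A B a) = 0 := by
    rw [← hP, Polynomial.eval_map, Polynomial.eval₂_at_apply, ha, map_zero]
  rw [prodXSubSMul, Polynomial.eval_prod, Finset.prod_eq_zero_iff] at hroot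
  -- The lifted root is a conjugate of `α`, so `α` comes from `A` and is fixed by `G`. This
  -- contradicts `α ≡ 1` and `g₀ • α ≡ 0` modulo `Q`.
  obtain ⟨c, -, hc⟩ := hroot
  induction c using QuotientGroup.induction_on with
  | H g =>
    have hga : g • α = algebraMap A B a := by
      simp [MulAction.ofQuotientStabilizer_mk, sub_eq_zero] at hc
      exact hc.symm
    have hαa : α = algebraMap A B a := by
      rw [← inv_smul_smul g α, hga, smul_algebraMap]
    have h1 := hα₀ g₀ hne
    rw [hαa, smul_algebraMap, ← hαa, ← Ideal.Quotient.eq_zero_iff_mem, hα₁] at h1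
    exact one_ne_zero h1

section

variable {A F E : Type*} [CommRing A] [Field F] [Field E] [Algebra A F] [Algebra F E]
  [Algebra A E] [IsScalarTower A F E]

theorem HenselianLocalRing.isLocalRing_integralClosure_of_isGalois [HenselianLocalRing A]
    [IsDomain A] [IsIntegrallyClosed A] [IsFractionRing A F] [FiniteDimensional F E]
    [IsGalois F E] : IsLocalRing (integralClosure A E) := by
  have : IsFractionRing (integralClosure A E) E :=
    integralClosure.isFractionRing_of_finite_extension F E
  let := IsIntegralClosure.MulSemiringAction A F E (integralClosure A E)
  have := Algebra.isInvariant_of_isGalois A F E (integralClosure A E)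
  have : SMulCommClass Gal(E/F) A (integralClosure A E) :=
    ⟨fun g a b => map_smul (galRestrict A F E (integralClosure A E) g) a b⟩
  exact isLocalRing_of_isInvariant (A := A) (G := Gal(E/F))

end

/-- An inverse in `N` of an element of `E` already lies in `E`, so the inclusion of integral
closures reflects units. -/
theorem IsLocalRing.integralClosure_of_tower {A E N : Type*} [CommRing A] [Field E] [Field N]
    [Algebra A E] [Algebra A N] [Algebra E N] [IsScalarTower A E N]
    [IsLocalRing (integralClosure A N)] : IsLocalRing (integralClosure A E) := by
  let f : integralClosure A E →+* integralClosure A N :=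
    ((IsScalarTower.toAlgHom A E N).mapIntegralClosure).toRingHom
  have hf : ∀ x, (f x : N) = algebraMap E N x := fun x => rfl
  have : IsLocalHom f := ⟨fun x hx => by
    obtain ⟨y, hy⟩ := hx.exists_right_inv
    have hy' : algebraMap E N x * y = 1 := by rw [← hf]; exact_mod_cast congr_arg Subtype.val hy
    have hx0 : (x : E) ≠ 0 := by rintro h; simp [h] at hy'
    have hyx : (y : N) = algebraMap E N (x : E)⁻¹ := by
      rw [map_inv₀]; exact eq_inv_of_mul_eq_one_right hy'
    have hint : IsIntegral A (x : E)⁻¹ := by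
      rw [← isIntegral_algebraMap_iff (algebraMap E N).injective, ← hyx]; exact y.2
    exact .of_mul_eq_one ⟨_, hint⟩ (Subtype.ext (mul_inv_cancel₀ hx0))⟩
  exact RingHom.domain_isLocalRing f

/-! ### Integrality of truncated polynomials at a root -/

namespace Polynomial

theorem coeff_divX_iterate {R : Type*} [Semiring R] (k n : ℕ) (p : R[X]) :
    (divX^[k] p).coeff n = p.coeff (n + k) := by
  induction k generalizing n p with
  | zero => rfl
  | succ k ih => rw [Function.iterate_succ_apply, ih, coeff_divX, add_assoc]

theorem aeval_divX_iterate {R S : Type*} [CommRing R] [CommRing S] [Algebra R S] (f : R[X]) (x : S)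
    (k : ℕ) : aeval x (divX^[k] f) =
      x * aeval x (divX^[k + 1] f) + algebraMap R S (f.coeff k) := by
  have h := congr_arg (aeval x) (divX_mul_X_add (divX^[k] f))
  rw [map_add, map_mul, aeval_X, aeval_C, coeff_divX_iterate, zero_add] at h
  rw [← h, Function.iterate_succ_apply', mul_comm]

/-- If `x` is a root of `f`, then the quotients of `f` by powers of `X` (dropping remainders),
as well as their products with `x`, take integral values at `x`. -/
theorem isIntegral_aeval_divX_iterate {R S : Type*} [CommRing R] [CommRing S]
    [IsDomain S] [Algebra R S] {f : R[X]} {x : S} (hx : aeval x f = 0) (k : ℕ) :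
    IsIntegral R (aeval x (divX^[k] f)) ∧ IsIntegral R (x * aeval x (divX^[k] f)) := by
  have hdecomp : ∀ k : ℕ, f = divX^[k] f * X ^ k + ∑ i ∈ Finset.range k, C (f.coeff i) * X ^ i := by
    intro k
    induction k with
    | zero => simp
    | succ k ih =>
      rw [Finset.sum_range_succ, Function.iterate_succ_apply']
      have h := divX_mul_X_add (divX^[k] f)
      rw [coeff_divX_iterate, zero_add] at h
      linear_combination ih - X ^ k * h
  have hmul : ∀ k : ℕ, IsIntegral R (aeval x (divX^[k + 1] f)) →
      IsIntegral R (x * aeval x (divX^[k + 1] f)) := by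
    intro k hk
    by_cases h0 : aeval x (divX^[k + 1] f) = 0
    · rw [h0, mul_zero]; exact isIntegral_zero
    -- `x` is a root of `c X ^ (k + 1)` plus lower terms, and leading coefficient times root is
    -- integral.
    let c : integralClosure R S := ⟨_, hk⟩
    let r : (integralClosure R S)[X] :=
      ∑ i ∈ Finset.range (k + 1), C (algebraMap R _ (f.coeff i)) * X ^ i
    have hr : r.degree < (C c * X ^ (k + 1)).degree := by
      rw [degree_C_mul_X_pow _ fun h => h0 (congr_arg Subtype.val h)]
      refine (degree_sum_le _ _).trans_lt ((Finset.sup_lt_iff (WithBot.bot_lt_coe _)).mpr ?_)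
      intro i hi
      exact (degree_C_mul_X_pow_le _ _).trans_lt (by exact_mod_cast Finset.mem_range.mp hi)
    have hroot : aeval x (C c * X ^ (k + 1) + r) = 0 := by
      rw [← hx]
      conv_rhs => rw [hdecomp (k + 1)]
      simp only [r, map_add, map_mul, map_sum, aeval_C, map_pow, aeval_X,
        ← IsScalarTower.algebraMap_apply]
      rfl
    have := isIntegral_leadingCoeff_smul _ _ hroot
    rw [leadingCoeff_add_of_degree_lt' hr, leadingCoeff_C_mul_X_pow] at this
    rw [mul_comm]
    exact isIntegral_trans _ this
  -- Descending induction on `k`, driven by `j`: the truncation is zero once `k` exceeds the degree.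
  have hint : ∀ j k : ℕ, f.natDegree + 1 ≤ k + j → IsIntegral R (aeval x (divX^[k] f)) := by
    intro j
    induction j with
    | zero =>
      intro k hk
      have : divX^[k] f = 0 := by
        ext n
        rw [coeff_divX_iterate, coeff_zero, coeff_eq_zero_of_natDegree_lt (by omega)]
      rw [this, map_zero]; exact isIntegral_zero
    | succ j ih =>
      intro k hk
      rw [aeval_divX_iterate]
      exact (hmul k (ih (k + 1) (by omega))).add isIntegral_algebraMap
  refine ⟨hint _ k (Nat.le_add_left _ _), ?_⟩
  cases k with
  | zero => rw [Function.iterate_zero_apply, hx, mul_zero]; exact isIntegral_zero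
  | succ k => exact hmul k (hint _ (k + 1) (Nat.le_add_left _ _))

end Polynomial

/-! ### Traces of integral non-units -/

section

variable {A F E N : Type*} [CommRing A] [Field F] [Field E] [Field N] [Algebra A F] [Algebra F E]
  [Algebra A E] [IsScalarTower A F E] [Algebra F N] [Algebra A N] [IsScalarTower A F N]

/-- If the integral closure of `A` in a splitting extension `N` of `F` is local, then the trace of
an integral non-unit cannot be `1`. -/
theorem Algebra.trace_ne_one_of_isIntegral_of_not_isIntegral_inv [FiniteDimensional F E]
    [IsLocalRing (integralClosure A N)]
    (hN : ∀ x : E, ((minpoly F x).map (algebraMap F N)).Splits)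
    {x : E} (hx : IsIntegral A x) (hx' : ¬ IsIntegral A x⁻¹) : Algebra.trace F E x ≠ 1 := by
  intro h1
  have hsum := trace_eq_sum_roots (F := N) (hN x)
  rw [h1, map_one] at hsum
  -- The maximal ideal as an additive subgroup of `N`. It contains each conjugate `ψ x`, since a
  -- unit `ψ x` would make `x⁻¹` integral, and so it contains the trace.
  let M : AddSubgroup N := (IsLocalRing.maximalIdeal (integralClosure A N)).toAddSubgroup.map
    (integralClosure A N).val.toLinearMap.toAddMonoidHom
  have hroot : ∀ r ∈ (minpoly F x).aroots N, r ∈ M := by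
    intro r hr
    obtain ⟨ψ, rfl⟩ : r ∈ Set.range fun ψ : E →ₐ[F] N => ψ x := by
      rw [Algebra.IsAlgebraic.range_eval_eq_rootSet_minpoly_of_splits N hN]
      simpa [Polynomial.rootSet] using hr
    have hψ : ∀ y : E, IsIntegral A (ψ y) ↔ IsIntegral A y := fun y =>
      isIntegral_algHom_iff (ψ.restrictScalars A) ψ.injective
    refine ⟨⟨ψ x, (hψ x).2 hx⟩, (IsLocalRing.mem_maximalIdeal _).2 fun hu => hx' ?_, rfl⟩
    obtain ⟨y, hy⟩ := hu.exists_right_inv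
    have hy' : ψ x * y = 1 := congr_arg Subtype.val hy
    rw [← hψ, map_inv₀, ← eq_inv_of_mul_eq_one_right hy']
    exact y.2
  have h1M : (1 : N) ∈ M := by
    rw [hsum]
    exact M.nsmul_mem (M.multiset_sum_mem _ hroot) _
  obtain ⟨y, hy, hy1⟩ := h1M
  have : y = 1 := Subtype.ext hy1
  rw [this] at hy
  exact (IsLocalRing.mem_maximalIdeal _).1 hy isUnit_one

end

/-! ### Orthogonal bases from projections -/

/-- A finite-dimensional non-archimedean normed space in which every line is the image of a
norm-decreasing projection has an orthogonal basis. -/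
theorem exists_orthogonal_basis_of_forall_exists_projection {F : Type*} [Field F] :
    ∀ (n : ℕ) {V : Type*} [AddCommGroup V] [Module F V] [FiniteDimensional F V]
      (_ : Module.finrank F V = n) (N : V → WithTop ℝ) (_ : N 0 = ⊤)
      (_ : ∀ x y, min (N x) (N y) ≤ N (x + y)) (_ : ∀ x, N (-x) = N x)
      (_ : ∀ e : V, e ≠ 0 → ∃ φ : V →ₗ[F] F, φ e = 1 ∧ ∀ x, N x ≤ N (φ x • e)),
      ∃ b : Module.Basis (Fin n) F V,
        ∀ c : Fin n → F, N (∑ i, c i • b i) = Finset.univ.inf fun i => N (c i • b i) := by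
  intro n
  induction n with
  | zero =>
    intro V _ _ _ hV N h0 _ _ _
    exact ⟨Module.finBasisOfFinrankEq F V hV, fun c => by simp [h0]⟩
  | succ n ih =>
    intro V _ _ _ hV N h0 hadd hneg hproj
    have : Nontrivial V := Module.nontrivial_of_finrank_pos (R := F) (by omega)
    obtain ⟨e, he⟩ := exists_ne (0 : V)
    obtain ⟨φ, hφ, hN⟩ := hproj e he
    have hsurj : Function.Surjective φ := fun c => ⟨c • e, by simp [hφ]⟩
    have hker : Module.finrank F (LinearMap.ker φ) = n := by
      have := φ.finrank_range_add_finrank_ker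
      rw [LinearMap.range_eq_top.2 hsurj, finrank_top, Module.finrank_self] at this
      omega
    obtain ⟨b, hb⟩ := ih hker (fun x => N x) h0 (fun x y => hadd x y) (fun x => hneg x) (by
      intro f hf
      obtain ⟨ψ, hψ, hψN⟩ := hproj f fun h => hf (Subtype.ext h)
      exact ⟨ψ.comp (LinearMap.ker φ).subtype, hψ, fun x => hψN x⟩)
    have horth : ∀ (c : F) (y : LinearMap.ker φ), N (c • e + y) = min (N (c • e)) (N y) := by
      intro c y
      -- Since `φ` sends `c • e + y` to `c`, the projection bound rules out cancellation between the
      -- two summands.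
      have h1 : N (c • e + y) ≤ N (c • e) := by
        have := hN (c • e + y)
        rwa [map_add, map_smul, hφ, LinearMap.mem_ker.1 y.2, add_zero, smul_eq_mul,
          mul_one] at this
      refine le_antisymm (le_min h1 ?_) (hadd _ _)
      have h2 := hadd (c • e + y) (-(c • e))
      rwa [hneg, min_eq_left h1, add_neg_cancel_comm] at h2
    have hcons : ∀ c : F, ∀ y ∈ LinearMap.ker φ, c • e + y = 0 → c = 0 := by
      intro c y hy h
      simpa [hφ, LinearMap.mem_ker.1 hy] using congr_arg φ h
    refine ⟨Module.Basis.mkFinCons e b hcons fun z => ⟨-φ z, by simp [hφ]⟩, fun c => ?_⟩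
    have := hb fun i => c i.succ
    have h := horth (c 0) (∑ i, c i.succ • b i)
    push_cast at this h
    rw [Fin.sum_univ_succ, Fin.univ_succ, Finset.inf_cons, Finset.inf_map]
    simp only [Module.Basis.coe_mkFinCons, Fin.cons_zero, Fin.cons_succ, Function.comp_def]
    rw [h, this]
    rfl

/-! ### Valuations, integrality and the trace bound -/

namespace RealValuation

variable {F E : Type*} [Field F] [Field E] [Algebra F E]

theorem mem_maximalIdeal_iff (v : RealValuation F) (a : v.valuationRing) :
    a ∈ IsLocalRing.maximalIdeal v.valuationRing ↔ 0 < v a := by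
  rw [IsLocalRing.mem_maximalIdeal, mem_nonunits_iff]
  refine ⟨fun h => lt_of_le_of_ne a.2 fun h0 => h ?_, fun h hu => ?_⟩
  · have ha : (a : F) ≠ 0 := fun ha => by simp [ha] at h0
    have h1 : v a + v (a : F)⁻¹ = 0 := by rw [← v.map_mul, mul_inv_cancel₀ ha, v.map_one]
    rw [← h0, zero_add] at h1
    exact .of_mul_eq_one ⟨(a : F)⁻¹, h1.ge⟩ (Subtype.ext (mul_inv_cancel₀ ha))
  · obtain ⟨b, hb⟩ := hu.exists_right_inv
    have h1 : v a + v b = 0 := by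
      rw [← v.map_mul, ← v.map_one]; exact congr_arg v (congr_arg Subtype.val hb)
    exact (h.trans_le (le_add_of_nonneg_right b.2)).ne' h1

theorem map_natCast_eq_zero (v : RealValuation F) {n : ℕ} (hn : n ≠ 0)
    (hdeg : n.Coprime (ringExpChar v.ResidueField)) : v (n : F) = 0 := by
  have h0 : ((n : ℕ) : v.ResidueField) ≠ 0 := by
    obtain ⟨p, hp⟩ := ExpChar.exists v.ResidueField
    rw [ringExpChar.eq v.ResidueField p] at hdeg
    cases hp with
    | zero => exact Nat.cast_ne_zero.mpr hn
    | prime hp =>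
      rw [Ne, CharP.cast_eq_zero_iff v.ResidueField p]
      exact fun h => hp.one_lt.ne' (Nat.eq_one_of_dvd_coprimes hdeg h dvd_rfl)
  have h1 : ((n : ℕ) : v.valuationRing) ∉ IsLocalRing.maximalIdeal v.valuationRing := by
    rwa [← IsLocalRing.residue_eq_zero_iff, map_natCast]
  rw [mem_maximalIdeal_iff, not_lt] at h1
  exact le_antisymm (by exact_mod_cast h1) (by exact_mod_cast ((n : ℕ) : v.valuationRing).2)

/-- A finite extension of degree coprime to the residue characteristic exponent is separable. -/
theorem isSeparable_of_coprime [FiniteDimensional F E] (v : RealValuation F)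
    (hdeg : (Module.finrank F E).Coprime (ringExpChar v.ResidueField)) :
    Algebra.IsSeparable F E := by
  have hn : ((Module.finrank F E : ℕ) : F) ≠ 0 := fun h => by
    have := v.map_natCast_eq_zero Module.finrank_pos.ne' hdeg
    simp [h] at this
  obtain ⟨q, hq⟩ := ExpChar.exists F
  rw [isSeparable_iff_finInsepDegree_eq_one]
  obtain ⟨k, hk⟩ := finInsepDegree_eq_pow F E q
  have hdvd : q ^ k ∣ Module.finrank F E := by
    rw [← hk, ← Field.finSepDegree_mul_finInsepDegree F E]; exact dvd_mul_left _ _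
  rw [hk]
  cases hq with
  | zero => simp
  | prime hq =>
    rw [Ne, CharP.cast_eq_zero_iff F q] at hn
    cases k with
    | zero => simp
    | succ k => exact absurd ((dvd_pow_self q k.succ_ne_zero).trans hdvd) hn

variable {v : RealValuation F} {w : RealValuation E}

/-- The inclusion of valuation rings induced by an extension of valuations. -/
def Extends.valuationRingHom (hw : w.Extends v) : v.valuationRing →+* w.valuationRing :=
  ((algebraMap F E).comp v.valuationRing.subtype).codRestrict w.valuationRing
    fun a => (hw a).ge.trans' a.2

theorem Extends.nonneg_of_isIntegral (hw : w.Extends v) {x : E}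
    (hx : IsIntegral v.valuationRing x) : 0 ≤ w x := by
  have h : IsIntegral w.valuationRing x :=
    hx.map_of_comp_eq hw.valuationRingHom (RingHom.id E) rfl
  obtain ⟨y, rfl⟩ := IsIntegrallyClosed.isIntegral_iff.mp h
  exact y.2

/-- By integrality, the elements of positive value form a maximal ideal of the integral closure.
Locality makes it the only one, so `y`, lying outside it, is a unit. -/
theorem Extends.isIntegral_inv_of_eq_zero (hw : w.Extends v)
    [IsLocalRing (integralClosure v.valuationRing E)] {y : E}
    (hy : IsIntegral v.valuationRing y) (h0 : w y = 0) : IsIntegral v.valuationRing y⁻¹ := by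
  let j : integralClosure v.valuationRing E →+* w.valuationRing :=
    (integralClosure v.valuationRing E).val.toRingHom.codRestrict w.valuationRing
      fun b => hw.nonneg_of_isIntegral b.2
  let Q := (IsLocalRing.maximalIdeal w.valuationRing).comap j
  have hQ : ∀ b, b ∈ Q ↔ 0 < w b := fun b => w.mem_maximalIdeal_iff (j b)
  have hunder : Q.comap (algebraMap v.valuationRing _) =
      IsLocalRing.maximalIdeal v.valuationRing := by
    ext a
    rw [Ideal.mem_comap, hQ, mem_maximalIdeal_iff, ← hw]
    rfl
  have hmax : Q.IsMaximal :=
    Ideal.isMaximal_of_isIntegral_of_isMaximal_comap (R := v.valuationRing) Q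
      (hunder ▸ inferInstance)
  have hyQ : (⟨y, hy⟩ : integralClosure v.valuationRing E) ∉ Q := by
    rw [hQ]; exact h0.not_gt
  rw [IsLocalRing.eq_maximalIdeal hmax, IsLocalRing.notMem_maximalIdeal] at hyQ
  obtain ⟨z, hz⟩ := hyQ.exists_right_inv
  rw [← eq_inv_of_mul_eq_one_right (congr_arg Subtype.val hz : y * z = 1)]
  exact z.2

open Polynomial in
/-- An algebraic element is a root of a polynomial over the valuation ring having a coefficient
equal to `1` all of whose higher coefficients lie in the maximal ideal. -/
theorem exists_aeval_eq_zero_coeff_eq_one (v : RealValuation F) {x : E} (hx : IsAlgebraic F x) :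
    ∃ (f : v.valuationRing[X]) (k : ℕ), aeval x f = 0 ∧ f.coeff k = 1 ∧
      ∀ i, k < i → 0 < v (f.coeff i) := by
  obtain ⟨p, hp0, hp⟩ := hx
  -- The lexicographic order with dual index selects the last coefficient of minimal value, so all
  -- higher ones are strictly larger in value.
  obtain ⟨k, hk, hmin⟩ := p.support.exists_min_image
    (fun i => toLex (v (p.coeff i), OrderDual.toDual i)) (nonempty_support_iff.mpr hp0)
  rw [mem_support_iff] at hk
  have hmin' : ∀ i, v (p.coeff k) < v (p.coeff i) ∨ v (p.coeff k) = v (p.coeff i) ∧ i ≤ k := by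
    intro i
    by_cases hi : p.coeff i = 0
    · left
      rw [hi, v.map_zero, lt_top_iff_ne_top, Ne, v.top_iff]
      exact hk
    · simpa [Prod.Lex.toLex_le_toLex] using hmin i (mem_support_iff.mpr hi)
  have hmul : ∀ i, v (p.coeff k) + v ((C (p.coeff k)⁻¹ * p).coeff i) = v (p.coeff i) := by
    intro i
    rw [coeff_C_mul, ← v.map_mul, mul_inv_cancel_left₀ hk]
  obtain ⟨f, hf⟩ : C (p.coeff k)⁻¹ * p ∈ lifts (algebraMap v.valuationRing F) := by
    rw [lifts_iff_coeff_lifts]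
    intro i
    refine ⟨⟨_, (?_ : 0 ≤ v ((C (p.coeff k)⁻¹ * p).coeff i))⟩, rfl⟩
    by_contra! h
    have h1 : v (p.coeff i) < v (p.coeff k) := by
      have h2 := WithTop.add_lt_add_left (mt v.top_iff.mp hk) h
      rwa [hmul, add_zero] at h2
    rcases hmin' i with h2 | h2
    · exact h2.not_gt h1
    · exact h1.ne' h2.1
  have hcoeff : ∀ i, (f.coeff i : F) = (C (p.coeff k)⁻¹ * p).coeff i := fun i => by
    rw [← hf, coe_mapRingHom, coeff_map]; rfl
  refine ⟨f, k, ?_, Subtype.ext ?_, fun i hi => ?_⟩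
  · rw [← aeval_map_algebraMap F, ← coe_mapRingHom, hf, map_mul, hp, mul_zero]
  · rw [hcoeff, coeff_C_mul, inv_mul_cancel₀ hk]; rfl
  · rw [hcoeff]
    have h1 : v (p.coeff k) < v (p.coeff i) := (hmin' i).resolve_right fun h => h.2.not_gt hi
    rw [← hmul i] at h1
    by_contra! h
    exact h1.not_ge (add_le_of_nonpos_right h)

-- The truncation `y` of `f` at `x` has constant term 1 and its other terms have positive value, so
-- `w y = 0`. As `y`, `x y` and hence `y⁻¹` are integral, so is `x = (x y) y⁻¹`.
open Polynomial in
theorem Extends.isIntegral_of_nonneg [FiniteDimensional F E] (hw : w.Extends v)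
    [IsLocalRing (integralClosure v.valuationRing E)] {x : E} (hx : 0 ≤ w x) :
    IsIntegral v.valuationRing x := by
  obtain ⟨f, k, hf, hk, hlt⟩ :=
    v.exists_aeval_eq_zero_coeff_eq_one (Algebra.IsAlgebraic.isAlgebraic (R := F) x)
  obtain ⟨hy, hxy⟩ := isIntegral_aeval_divX_iterate hf k
  set y := aeval x (divX^[k] f) with hydef
  have hwy : w y = 0 := by
    rw [hydef, aeval_divX_iterate, hk, map_one, add_comm, ← w.map_one]
    refine w.map_add_eq_of_lt_left ?_
    rw [w.map_one, w.map_mul]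
    refine lt_of_lt_of_le ?_ (le_add_of_nonneg_left hx)
    rw [aeval_eq_sum_range]
    refine w.map_lt_sum (by simp) fun i _ => ?_
    rw [Algebra.smul_def, w.map_mul, w.map_pow, coeff_divX_iterate,
      IsScalarTower.algebraMap_apply v.valuationRing F E, hw]
    exact (hlt _ (by omega)).trans_le (le_add_of_nonneg_right (nsmul_nonneg hx i))
  have hy0 : y ≠ 0 := fun h => by simp [h] at hwy
  have := hxy.mul (hw.isIntegral_inv_of_eq_zero hy hwy)
  rwa [mul_inv_cancel_right₀ hy0] at this

/-- The trace of a finite separable extension of a henselian field does not decrease the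
valuation. -/
theorem Extends.le_map_trace [FiniteDimensional F E] [Algebra.IsSeparable F E]
    (hw : w.Extends v) (hv : v.IsHenselian) (x : E) : w x ≤ v (Algebra.trace F E x) := by
  have : HenselianLocalRing v.valuationRing := hv
  have : Algebra.IsSeparable F (SeparableClosure E) := Algebra.IsSeparable.trans F E _
  have : IsSepClosure F (SeparableClosure E) := ⟨inferInstance, inferInstance⟩
  have : IsGalois F (SeparableClosure E) := inferInstance
  let N := IntermediateField.normalClosure F E (SeparableClosure E)
  have : Nonempty (E →ₐ[F] SeparableClosure E) := ⟨IsScalarTower.toAlgHom F E _⟩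
  have : IsNormalClosure F E N := isNormalClosure_normalClosure F E _
  have : IsLocalRing (integralClosure v.valuationRing N) :=
    HenselianLocalRing.isLocalRing_integralClosure_of_isGalois (F := F)
  have : IsLocalRing (integralClosure v.valuationRing E) :=
    IsLocalRing.integralClosure_of_tower (N := N)
  -- Dividing by the trace `t` gives an element of trace 1 and positive value, whose inverse has
  -- negative value and so is not integral.
  by_contra! h
  set t := Algebra.trace F E x with ht
  have ht0 : t ≠ 0 := fun h0 => by simp [h0] at h
  have htr : Algebra.trace F E (t⁻¹ • x) = 1 := by
    rw [map_smul, ← ht, smul_eq_mul, inv_mul_cancel₀ ht0]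
  have hx0 : t⁻¹ • x ≠ 0 := fun h0 => by simp [h0] at htr
  have hpos : 0 < w (t⁻¹ • x) := by
    by_contra! h1
    have h2 : w x = v t + w (t⁻¹ • x) := by
      rw [← hw, ← w.map_mul, ← Algebra.smul_def, smul_inv_smul₀ ht0]
    rw [h2] at h
    exact h.not_ge (add_le_of_nonpos_right h1)
  refine Algebra.trace_ne_one_of_isIntegral_of_not_isIntegral_inv (A := v.valuationRing) (N := N)
    (IsNormalClosure.splits (L := N)) (hw.isIntegral_of_nonneg hpos.le) (fun hinv => ?_) htr
  have h1 := hpos.trans_le (le_add_of_nonneg_right (hw.nonneg_of_isIntegral hinv))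
  rw [← w.map_mul, mul_inv_cancel₀ hx0, w.map_one] at h1
  exact h1.false

end RealValuation

theorem corollary4p6 {F E : Type*} [Field F] [Field E] [Algebra F E] [FiniteDimensional F E]
    (v : RealValuation F) (hv : v.IsHenselian)
    (w : RealValuation E) (hw : w.Extends v)
    (hdeg : (Module.finrank F E).Coprime (ringExpChar v.ResidueField)) :
    ∃ e : Module.Basis (Fin (Module.finrank F E)) F E, w.IsValuationBasis e := by
  have : Algebra.IsSeparable F E := v.isSeparable_of_coprime hdeg
  have hn := v.map_natCast_eq_zero Module.finrank_pos.ne' hdeg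
  have hn0 : ((Module.finrank F E : ℕ) : F) ≠ 0 := fun h => by simp [h] at hn
  refine exists_orthogonal_basis_of_forall_exists_projection _ rfl w w.map_zero
    (fun x y => w.map_add x y) w.map_neg fun e he => ?_
  -- The factor `n⁻¹` compensates `Tr 1 = n` and has value 0, so the trace bound survives
  -- normalisation.
  refine ⟨((Module.finrank F E : ℕ) : F)⁻¹ •
    (Algebra.trace F E).comp (LinearMap.mulRight F e⁻¹), ?_, fun x => ?_⟩
  · have := Algebra.trace_algebraMap (S := E) (1 : F)
    rw [map_one] at this
    simp [he, this, hn0]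
  · have hinv : v ((Module.finrank F E : ℕ) : F)⁻¹ = 0 := by
      have := v.map_mul ((Module.finrank F E : ℕ) : F) ((Module.finrank F E : ℕ) : F)⁻¹
      rwa [mul_inv_cancel₀ hn0, v.map_one, hn, zero_add, eq_comm] at this
    have h := hw.le_map_trace hv (x * e⁻¹)
    rw [LinearMap.smul_apply, LinearMap.comp_apply, LinearMap.mulRight_apply, Algebra.smul_def,
      w.map_mul, hw, smul_eq_mul, v.map_mul, hinv, zero_add]
    calc w x = w (x * e⁻¹) + w e := by rw [← w.map_mul, inv_mul_cancel_right₀ he]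
      _ ≤ _ := add_le_add_left h _
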